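/- Let $\Omega$ be a totally disconnected compact metrizable space and let $T:\Omega\to\Omega$ be a minimal homeomorphism, that is, every orbit $\{T^n x : n\in\mathbb Z\}$ is dense in $\Omega$. (This covers every minimal subshift over a finite alphabet, i.e. a closed shift-invariant set $\Omega\subseteq A^{\mathbb Z}$, $A$ finite, with $T$ the left shift and all orbits dense, and also every minimal homeomorphism of the Cantor set.) Let $G_T$ be the topological full group of $(\Omega,T)$: the group, under composition, of all homeomorphisms $S:\Omega\to\Omega$ for which there is a continuous function $f:\Omega\to\mathbb Z$ with $S(x)=T^{f(x)}(x)$ for all $x\in\Omega$. Let $G_T'=[G_T,G_T]$ be its commutator subgroup. Then: (1) every element of $G_T'$ is a product of at most two commutators of elements of $G_T$; (2) every element of $G_T'$ is a product of at most four involutions (elements of order two) of $G_T$, the empty product being the identity. -/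

import Mathlib

/-- The homeomorphism `T` is minimal: every (two-sided) `T`-orbit is dense. -/
def IsMinimalHomeo {X : Type*} [TopologicalSpace X] (T : X ≃ₜ X) : Prop :=
  ∀ x : X, Dense (Set.range fun n : ℤ => (T ^ n) x)

/-- The topological full group of `(X, T)`: the group of all homeomorphisms `S` of `X` for which
there is a continuous function `f : X → ℤ` (an orbit cocycle) with `S x = T ^ (f x) x` for
all `x`. Multiplication is composition, acting on the left. -/
def topologicalFullGroup {X : Type*} [TopologicalSpace X] (T : X ≃ₜ X) : Subgroup (X ≃ₜ X) where
  carrier := {S | ∃ f : X → ℤ, Continuous f ∧ ∀ x, S x = (T ^ f x) x}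
  one_mem' := ⟨fun _ => 0, continuous_const, fun x => by simp⟩
  mul_mem' := by
    rintro S₁ S₂ ⟨f₁, hf₁, h₁⟩ ⟨f₂, hf₂, h₂⟩
    refine ⟨fun x => f₁ (S₂ x) + f₂ x, (hf₁.comp S₂.continuous).add hf₂, fun x => ?_⟩
    have e : (S₁ * S₂) x = S₁ (S₂ x) := rfl
    rw [e, h₁ (S₂ x), zpow_add]
    change _ = (T ^ f₁ (S₂ x)) ((T ^ f₂ x) x)
    rw [← h₂ x]
  inv_mem' := by
    rintro S ⟨f, hf, h⟩
    refine ⟨fun x => -f (S⁻¹ x), (hf.comp (S⁻¹).continuous).neg, fun x => ?_⟩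
    have e : S (S⁻¹ x) = x := S.apply_symm_apply x
    have e' := h (S⁻¹ x)
    rw [e] at e'
    rw [zpow_neg]
    have e2 : ((T ^ f (S⁻¹ x))⁻¹) x = (T ^ f (S⁻¹ x)).symm x := rfl
    rw [e2, Homeomorph.eq_symm_apply]
    exact e'.symm

/-! Call `g` good if `g = s * (h * s * h⁻¹)` with `s * s = 1`. A good element is a commutator and
also a product of two elements squaring to one, so both claims follow once every element of the
commutator subgroup is a product of two good ones. Even permutations of a finite set are good; this
settles finite `X`, where the full group is the whole symmetric group.

For infinite `X` the action is free, and two homomorphisms to abelian groups vanish on the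
commutator subgroup. `orbitIndex` is the net number of points carried into the forward orbit of a
point `w`. `orbitSign` is the class, modulo coboundaries `u - u ∘ T`, of the function counting mod 2
the points `q` after `p` in its orbit whose order with `p` is reversed.

Index zero allows a correction near `w`: some `c`, acting by even permutations on the towers over a
small clopen base, makes `g * c` preserve the forward orbit of `w`. By continuity `g * c` then
preserves the forward orbit of each point of a clopen neighbourhood of `w`, so it permutes each
tower over that neighbourhood. Its inversion count is some `u - u ∘ T`; summed along a tower this
telescopes to zero if `u` is constant on the base, so all tower permutations are even. Even tower
permutations are split by a rule depending only on height and permutation, so the pieces glue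
continuously. Thus `g * c` and `c⁻¹` are both good. -/

/-- `g` is the product of an element squaring to one and one of its conjugates. -/
def IsSqOneMulConj {G : Type*} [Group G] (g : G) : Prop :=
  ∃ s h : G, s * s = 1 ∧ g = s * (h * s * h⁻¹)

/-! ### Products of an element squaring to one with a conjugate of it -/

namespace IsSqOneMulConj

variable {G : Type*} [Group G]

theorem inv {g : G} (hg : IsSqOneMulConj g) : IsSqOneMulConj g⁻¹ := by
  obtain ⟨s, h, hs, rfl⟩ := hg
  have hs' : s⁻¹ = s := inv_eq_of_mul_eq_one_left hs
  refine ⟨h * s * h⁻¹, h⁻¹, ?_, ?_⟩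
  · calc h * s * h⁻¹ * (h * s * h⁻¹) = h * (s * s) * h⁻¹ := by group
      _ = 1 := by rw [hs]; group
  · simp only [mul_inv_rev, inv_inv, hs']
    group

theorem one : IsSqOneMulConj (1 : G) := ⟨1, 1, by simp, by simp⟩

theorem mem_commutatorSet {g : G} (hg : IsSqOneMulConj g) : g ∈ commutatorSet G := by
  obtain ⟨s, h, hs, rfl⟩ := hg
  have hs' : s⁻¹ = s := inv_eq_of_mul_eq_one_left hs
  exact ⟨s, h, by rw [commutatorElement_def, hs']; group⟩

theorem exists_mul_self_eq_one {g : G} (hg : IsSqOneMulConj g) :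
    ∃ s t : G, s * s = 1 ∧ t * t = 1 ∧ g = s * t := by
  obtain ⟨s, h, hs, rfl⟩ := hg
  refine ⟨s, h * s * h⁻¹, hs, ?_, rfl⟩
  calc h * s * h⁻¹ * (h * s * h⁻¹) = h * (s * s) * h⁻¹ := by group
    _ = 1 := by rw [hs]; group

end IsSqOneMulConj

/-- Elements squaring to one that are trivial may be dropped from a product. -/
theorem exists_list_orderOf_eq_two {G : Type*} [Group G] (l : List G)
    (hl : ∀ s ∈ l, s * s = 1) :
    ∃ l' : List G, l'.length ≤ l.length ∧ (∀ s ∈ l', orderOf s = 2) ∧ l.prod = l'.prod := by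
  induction l with
  | nil => exact ⟨[], by simp⟩
  | cons a l ih =>
    obtain ⟨l', h1, h2, h3⟩ := ih fun s hs => hl s (List.mem_cons_of_mem _ hs)
    by_cases ha : a = 1
    · exact ⟨l', by simp; omega, h2, by simp [ha, h3]⟩
    · refine ⟨a :: l', by simpa using h1, ?_, by simp [h3]⟩
      intro s hs
      rcases List.mem_cons.1 hs with rfl | hs
      · exact orderOf_eq_prime (by rw [pow_two]; exact hl _ (by simp)) ha
      · exact h2 s hs

/-! ### Even permutations of a finite set -/

namespace Equiv.Perm

variable {α : Type*} [Fintype α] [DecidableEq α]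

/-- The two factors have nearly equal supports, so parity alone will decide whether they are
conjugate. The prescribed fixed point `b` of `s` is what makes the induction go through. -/
theorem exists_mul_eq_of_card_support (n : ℕ) (σ : Perm α) (hn : σ.support.card = n) (b : α) :
    ∃ s t : Perm α, σ = s * t ∧ s * s = 1 ∧ t * t = 1 ∧
      (∀ x, σ x = x → s x = x ∧ t x = x) ∧ s b = b ∧
      (t.support.card = s.support.card ∨ t.support.card = s.support.card + 2) := by
  induction n using Nat.strong_induction_on generalizing σ b with
  | _ n ih =>
  have key : ∀ b, σ b ≠ b → ∃ s t : Perm α, σ = s * t ∧ s * s = 1 ∧ t * t = 1 ∧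
      (∀ x, σ x = x → s x = x ∧ t x = x) ∧ s b = b ∧
      (t.support.card = s.support.card ∨ t.support.card = s.support.card + 2) := by
    intro b hb
    have hlt : (swap b (σ b) * σ).support.card < n :=
      hn ▸ card_support_swap_mul hb
    -- Asking `s` to fix `σ b`, while `b` is already fixed, makes `s` disjoint from the removed
    -- transposition.
    obtain ⟨s, t, hst, hs, ht, hfix, hsb, hc⟩ := ih _ hlt (swap b (σ b) * σ) rfl (σ b)
    have hσ : σ = swap b (σ b) * (s * t) := by rw [← hst, ← mul_assoc, swap_mul_self, one_mul]
    have hbb := hfix b (by simp)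
    have hdis : Disjoint (swap b (σ b)) s := by
      intro x
      by_cases h1 : x = b
      · right; rw [h1]; exact hbb.1
      by_cases h2 : x = σ b
      · right; rw [h2]; exact hsb
      · left; exact swap_apply_of_ne_of_ne h1 h2
    have hss : swap b (σ b) * s * (swap b (σ b) * s) = 1 := by
      rw [mul_assoc, ← mul_assoc s, ← hdis.commute.eq]
      rw [← mul_assoc, ← mul_assoc, swap_mul_self, one_mul, hs]
    have hfix' : ∀ x, σ x = x → s x = x ∧ t x = x ∧ swap b (σ b) x = x := by
      intro x hx
      have h1 : x ≠ b := by rintro rfl; exact hb hx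
      have h2 : x ≠ σ b := by
        rintro rfl
        exact hb (σ.injective hx)
      have h3 := hfix x (by
        rw [mul_apply, hx]; exact swap_apply_of_ne_of_ne h1 h2)
      exact ⟨h3.1, h3.2, swap_apply_of_ne_of_ne h1 h2⟩
    have htinv : t⁻¹ = t := inv_eq_of_mul_eq_one_left ht
    -- The factors of `σ = (swap * s) * t` are interchanged at the cost of a conjugation, because
    -- `t` fixes `b` and becomes the new first factor. The other support grows by 2, so the
    -- difference 0 or 2 becomes 2 or 0.
    refine ⟨t, t * (swap b (σ b) * s) * t⁻¹, ?_, ht, ?_, ?_, hbb.2, ?_⟩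
    · rw [htinv, ← mul_assoc, ← mul_assoc, ht, one_mul, mul_assoc]; exact hσ
    · calc _ = t * (swap b (σ b) * s * (swap b (σ b) * s)) * t⁻¹ := by group
        _ = 1 := by rw [hss]; group
    · intro x hx
      obtain ⟨h1, h2, h3⟩ := hfix' x hx
      refine ⟨h2, ?_⟩
      rw [htinv]
      simp only [mul_apply, h1, h2, h3]
    · rw [card_support_conj, hdis.card_support_mul, card_support_swap hb.symm]
      omega
  by_cases hb : σ b = b
  · by_cases h1 : σ = 1
    · subst h1
      exact ⟨1, 1, by simp⟩
    · obtain ⟨b', hb'⟩ : ∃ b', σ b' ≠ b' := by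
        by_contra! h
        exact h1 (Equiv.ext h)
      obtain ⟨s, t, h1, h2, h3, h4, -, h5⟩ := key b' hb'
      exact ⟨s, t, h1, h2, h3, h4, (h4 b hb).1, h5⟩
  · exact key b hb

theorem cycleType_of_mul_self_eq_one {s : Perm α} (hs : s * s = 1) :
    s.cycleType = Multiset.replicate (s.support.card / 2) 2 := by
  have h := cycleType_of_pow_prime_eq_one (p := 2) (σ := s) (by rw [pow_two, hs])
  have h2 := s.sum_cycleType
  rw [h] at h2 ⊢
  simp only [Multiset.sum_replicate, smul_eq_mul] at h2
  congr 1
  omega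

/-- An even permutation is the product of an involution and one of its conjugates. -/
theorem isSqOneMulConj_of_sign_eq_one (σ : Perm α) (hσ : sign σ = 1) : IsSqOneMulConj σ := by
  rcases isEmpty_or_nonempty α with h | ⟨⟨b⟩⟩
  · rw [Subsingleton.elim σ 1]
    exact .one
  obtain ⟨s, t, hst, hs, ht, -, -, hc⟩ := exists_mul_eq_of_card_support _ σ rfl b
  have hcs := cycleType_of_mul_self_eq_one hs
  have hct := cycleType_of_mul_self_eq_one ht
  have hcard : t.support.card = s.support.card := by
    -- Two more moved points mean exactly one more transposition, and `s * t` would be odd.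
    refine hc.resolve_right fun hc => ?_
    have h2 : t.support.card / 2 = s.support.card / 2 + 1 := by omega
    have hs' := sign_of_cycleType' s
    have ht' := sign_of_cycleType' t
    rw [hcs] at hs'
    rw [hct] at ht'
    simp only [Multiset.map_replicate, Multiset.prod_replicate] at hs' ht'
    rw [hst, sign_mul, hs', ht', h2, pow_succ _ (s.support.card / 2), ← mul_assoc,
      Int.units_mul_self, one_mul] at hσ
    exact absurd hσ (by decide)
  have : IsConj s t := isConj_iff_cycleType_eq.2 (by rw [hcs, hct, hcard])
  obtain ⟨h, hh⟩ := isConj_iff.1 this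
  exact ⟨s, h, hs, by rw [hh, hst]⟩

end Equiv.Perm

/-! ### Coboundaries and row sums of kernels on orbits -/

namespace TopFullGroup

variable {X : Type*} [TopologicalSpace X] {T : X ≃ₜ X}

theorem zpow_add_apply (T : X ≃ₜ X) (m n : ℤ) (x : X) : (T ^ (m + n)) x = (T ^ m) ((T ^ n) x) := by
  rw [zpow_add]; rfl

theorem zpow_neg_apply_zpow (T : X ≃ₜ X) (n : ℤ) (x : X) : (T ^ (-n)) ((T ^ n) x) = x := by
  rw [← zpow_add_apply]; simp

theorem zpow_apply_zpow_neg (T : X ≃ₜ X) (n : ℤ) (x : X) : (T ^ n) ((T ^ (-n)) x) = x := by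
  rw [← zpow_add_apply]; simp

theorem eq_zpow_neg_apply {n : ℤ} {x y : X} (h : y = (T ^ n) x) : x = (T ^ (-n)) y := by
  rw [h, zpow_neg_apply_zpow]

/-- No point is periodic. -/
def IsAperiodic (T : X ≃ₜ X) : Prop := ∀ (x : X) (n : ℤ), (T ^ n) x = x → n = 0

theorem IsAperiodic.eq_of_zpow_eq (hT : IsAperiodic T) {x : X} {m n : ℤ}
    (h : (T ^ m) x = (T ^ n) x) : m = n := by
  have := hT x (-n + m) (by rw [zpow_add_apply, h, zpow_neg_apply_zpow])
  omega

theorem exists_cocycle [CompactSpace X] (g : topologicalFullGroup T) :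
    ∃ f : X → ℤ, Continuous f ∧ (∀ x, (g : X ≃ₜ X) x = (T ^ f x) x) ∧
      ∃ N : ℕ, ∀ x, |f x| ≤ N := by
  obtain ⟨f, hf, h⟩ := g.2
  refine ⟨f, hf, h, ?_⟩
  obtain ⟨C, hC⟩ := ((isCompact_range hf).finite_of_discrete.image fun n => n.natAbs).bddAbove
  refine ⟨C, fun x => ?_⟩
  have := hC ⟨f x, ⟨x, rfl⟩, rfl⟩
  simp only at this
  rw [Int.abs_eq_natAbs]
  exact_mod_cast this

/-- Functions of the form `u - u ∘ T` with `u` continuous. -/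
def coboundaries (T : X ≃ₜ X) : AddSubgroup (X → ZMod 2) where
  carrier := {f | ∃ u : X → ZMod 2, Continuous u ∧ ∀ x, f x = u x - u (T x)}
  zero_mem' := ⟨0, continuous_const, by simp⟩
  add_mem' := by
    rintro a b ⟨u, hu, ha⟩ ⟨v, hv, hb⟩
    exact ⟨u + v, hu.add hv, fun x => by simp only [Pi.add_apply, ha, hb]; ring⟩
  neg_mem' := by
    rintro a ⟨u, hu, ha⟩
    exact ⟨-u, hu.neg, fun x => by simp only [Pi.neg_apply, ha]; ring⟩

theorem comp_zpow_sub_mem_coboundaries {u : X → ZMod 2} (hu : Continuous u) (n : ℤ) :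
    (fun x => u ((T ^ n) x) - u x) ∈ coboundaries T := by
  induction n using Int.induction_on with
  | zero => exact ⟨0, continuous_const, by simp⟩
  | succ n ih =>
    have h : (fun x => u ((T ^ ((n : ℤ) + 1)) x) - u ((T ^ (n : ℤ)) x)) ∈ coboundaries T :=
      ⟨fun x => -u ((T ^ (n : ℤ)) x), (hu.comp (Homeomorph.continuous _)).neg, fun x => by
        simp only [zpow_add_apply, zpow_one]; ring⟩
    convert (coboundaries T).add_mem h ih using 1
    ext x
    simp
  | pred n ih =>
    have h : (fun x => u ((T ^ (-(n : ℤ) - 1)) x) - u ((T ^ (-(n : ℤ))) x)) ∈ coboundaries T :=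
      ⟨fun x => u ((T ^ (-(n : ℤ) - 1)) x), hu.comp (Homeomorph.continuous _), fun x => by
        have := zpow_add_apply T (-(n : ℤ) - 1) 1 x
        rw [zpow_one] at this
        simp [← this]⟩
    convert (coboundaries T).add_mem h ih using 1
    ext x
    simp

/-- A kernel on `X` is orbital if it is supported on pairs of points of the same orbit at bounded
distance and depends continuously on the first point. -/
def IsOrbital (T : X ≃ₜ X) (k : X → X → ZMod 2) : Prop :=
  (∃ M : ℕ, ∀ p q, k p q ≠ 0 → ∃ n : ℤ, |n| ≤ M ∧ q = (T ^ n) p) ∧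
    ∀ n : ℤ, Continuous fun p => k p ((T ^ n) p)

/-- The sums of the rows of a kernel. -/
noncomputable def rowSum (k : X → X → ZMod 2) (p : X) : ZMod 2 := ∑ᶠ q, k p q

namespace IsOrbital

theorem add {k l : X → X → ZMod 2} (hk : IsOrbital T k) (hl : IsOrbital T l) :
    IsOrbital T (k + l) := by
  obtain ⟨⟨M, hM⟩, hk⟩ := hk
  obtain ⟨⟨N, hN⟩, hl⟩ := hl
  refine ⟨⟨max M N, fun p q h => ?_⟩, fun n => (hk n).add (hl n)⟩
  by_cases h1 : k p q = 0
  · obtain ⟨n, h2, h3⟩ := hN p q (fun h2 => h (by simp [h1, h2]))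
    exact ⟨n, by push_cast; exact le_max_of_le_right h2, h3⟩
  · obtain ⟨n, h2, h3⟩ := hM p q h1
    exact ⟨n, by push_cast; exact le_max_of_le_left h2, h3⟩

theorem neg {k : X → X → ZMod 2} (hk : IsOrbital T k) : IsOrbital T (-k) := by
  obtain ⟨⟨M, hM⟩, hk⟩ := hk
  exact ⟨⟨M, fun p q h => hM p q (by simpa using h)⟩, fun n => (hk n).neg⟩

theorem sub {k l : X → X → ZMod 2} (hk : IsOrbital T k) (hl : IsOrbital T l) :
    IsOrbital T (k - l) := by
  rw [sub_eq_add_neg]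
  exact hk.add hl.neg

theorem transpose {k : X → X → ZMod 2} (hk : IsOrbital T k) :
    IsOrbital T (fun p q => k q p) := by
  obtain ⟨⟨M, hM⟩, hk⟩ := hk
  refine ⟨⟨M, fun p q h => ?_⟩, fun n => ?_⟩
  · obtain ⟨n, h1, h2⟩ := hM q p h
    exact ⟨-n, by rwa [abs_neg], eq_zpow_neg_apply h2⟩
  · have := (hk (-n)).comp (T ^ n).continuous
    simpa only [Function.comp_def, zpow_neg_apply_zpow] using this

theorem comp [CompactSpace X] {k : X → X → ZMod 2} (hk : IsOrbital T k)
    (g : topologicalFullGroup T) :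
    IsOrbital T (fun p q => k ((g : X ≃ₜ X) p) ((g : X ≃ₜ X) q)) := by
  obtain ⟨⟨M, hM⟩, hk⟩ := hk
  obtain ⟨f, hf, hg, N, hN⟩ := exists_cocycle g
  refine ⟨⟨M + 2 * N, fun p q h => ?_⟩, fun n => ?_⟩
  · obtain ⟨n, h1, h2⟩ := hM _ _ h
    rw [hg p, hg q, ← zpow_add_apply] at h2
    refine ⟨-f q + (n + f p), ?_, ?_⟩
    · have := abs_le.1 (hN p)
      have := abs_le.1 (hN q)
      have := abs_le.1 h1
      rw [abs_le]
      push_cast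
      omega
    · rw [zpow_add_apply, ← h2, zpow_neg_apply_zpow]
  · have h : ∀ p, (g : X ≃ₜ X) ((T ^ n) p) =
        (T ^ (f ((T ^ n) p) + n - f p)) ((g : X ≃ₜ X) p) := by
      intro p
      rw [hg, hg, ← zpow_add_apply, ← zpow_add_apply]
      congr 2
      ring
    have hc : Continuous fun a : ℤ × X => k a.2 ((T ^ a.1) a.2) :=
      continuous_prod_of_discrete_left.2 hk
    have hm : Continuous fun p => (f ((T ^ n) p) + n - f p, (g : X ≃ₜ X) p) :=
      (((hf.comp (T ^ n).continuous).add continuous_const).sub hf).prodMk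
        (g : X ≃ₜ X).continuous
    simpa only [Function.comp_def, ← h] using hc.comp hm

theorem finite_support {k : X → X → ZMod 2} (hk : IsOrbital T k) (p : X) :
    (Function.support (k p)).Finite := by
  obtain ⟨⟨M, hM⟩, -⟩ := hk
  refine ((Set.finite_Icc (-(M : ℤ)) M).image fun n => (T ^ n) p).subset fun q hq => ?_
  obtain ⟨n, h1, h2⟩ := hM p q hq
  exact ⟨n, abs_le.1 h1, h2.symm⟩

theorem rowSum_add {k l : X → X → ZMod 2} (hk : IsOrbital T k) (hl : IsOrbital T l) :
    rowSum (k + l) = rowSum k + rowSum l := by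
  ext p
  exact finsum_add_distrib (hk.finite_support p) (hl.finite_support p)

theorem rowSum_sub {k l : X → X → ZMod 2} (hk : IsOrbital T k) (hl : IsOrbital T l) :
    rowSum (k - l) = rowSum k - rowSum l := by
  ext p
  exact finsum_sub_distrib (hk.finite_support p) (hl.finite_support p)

theorem rowSum_eq_sum (hT : IsAperiodic T) {k : X → X → ZMod 2} {M : ℕ}
    (hM : ∀ p q, k p q ≠ 0 → ∃ n : ℤ, |n| ≤ M ∧ q = (T ^ n) p) (p : X) :
    rowSum k p = ∑ n ∈ Finset.Icc (-(M : ℤ)) M, k p ((T ^ n) p) := by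
  classical
  rw [rowSum, finsum_eq_sum_of_support_subset (s := (Finset.Icc (-(M : ℤ)) M).image
    fun n => (T ^ n) p), Finset.sum_image fun a _ b _ h => hT.eq_of_zpow_eq h]
  intro q hq
  obtain ⟨n, h1, h2⟩ := hM p q hq
  simp only [Finset.coe_image, Set.mem_image, Finset.mem_coe, Finset.mem_Icc]
  exact ⟨n, abs_le.1 h1, h2.symm⟩

theorem continuous_rowSum (hT : IsAperiodic T) {k : X → X → ZMod 2} (hk : IsOrbital T k) :
    Continuous (rowSum k) := by
  obtain ⟨⟨M, hM⟩, hk⟩ := hk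
  rw [funext (rowSum_eq_sum hT hM)]
  exact continuous_finsetSum _ fun n _ => hk n

/-- Row and column sums add up the same functions `p ↦ k p (T ^ n p)`, except that each is
translated by a power of `T`. -/
theorem rowSum_transpose_sub_mem (hT : IsAperiodic T) {k : X → X → ZMod 2}
    (hk : IsOrbital T k) :
    rowSum (fun p q => k q p) - rowSum k ∈ coboundaries T := by
  obtain ⟨⟨M, hM⟩, hk⟩ := hk
  have hM' : ∀ p q, k q p ≠ 0 → ∃ n : ℤ, |n| ≤ M ∧ q = (T ^ n) p := by
    intro p q h
    obtain ⟨n, h1, h2⟩ := hM q p h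
    exact ⟨-n, by rwa [abs_neg], eq_zpow_neg_apply h2⟩
  have h : rowSum (fun p q => k q p) - rowSum k =
      ∑ n ∈ Finset.Icc (-(M : ℤ)) M, fun p =>
        k ((T ^ (-n)) p) ((T ^ n) ((T ^ (-n)) p)) - k p ((T ^ n) p) := by
    ext p
    rw [Pi.sub_apply, rowSum_eq_sum hT hM, rowSum_eq_sum hT hM', Finset.sum_apply,
      Finset.sum_sub_distrib]
    congr 1
    refine Finset.sum_bij' (fun n _ => -n) (fun n _ => -n) ?_ ?_ ?_ ?_ ?_
    · intro n hn; simp only [Finset.mem_Icc] at hn ⊢; omega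
    · intro n hn; simp only [Finset.mem_Icc] at hn ⊢; omega
    · simp
    · simp
    · intro n _
      rw [zpow_apply_zpow_neg, neg_neg]
  rw [h]
  exact sum_mem fun n _ => comp_zpow_sub_mem_coboundaries (hk n) (-n)

end IsOrbital

/-- Both functions are marginals of the kernel carrying `u` on the graph of `g`, so transposition
gives the claim. -/
theorem comp_sub_mem_coboundaries [CompactSpace X] (hT : IsAperiodic T) {u : X → ZMod 2}
    (hu : Continuous u) (g : topologicalFullGroup T) :
    (fun x => u ((g : X ≃ₜ X) x)) - u ∈ coboundaries T := by
  classical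
  obtain ⟨f, hf, hg, N, hN⟩ := exists_cocycle g
  let k : X → X → ZMod 2 := fun q p => if (g : X ≃ₜ X) p = q then u q else 0
  have hk : IsOrbital T (fun p q => k q p) := by
    refine ⟨⟨N, fun p q h => ?_⟩, fun n => ?_⟩
    · have h1 : (g : X ≃ₜ X) p = q := by
        by_contra h1
        exact h (if_neg h1)
      exact ⟨f p, hN p, by rw [← h1, hg]⟩
    · have h : (fun p => k ((T ^ n) p) p) = fun p => (if f p = n then 1 else 0) * u ((T ^ n) p) := by
        ext p
        simp only [k, hg, ite_mul, one_mul, zero_mul]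
        exact if_congr ⟨hT.eq_of_zpow_eq, fun h => by rw [h]⟩ rfl rfl
      rw [h]
      exact ((continuous_of_discreteTopology (f := fun m : ℤ => if m = n then (1 : ZMod 2) else 0)).comp
        hf).mul (hu.comp (T ^ n).continuous)
  have h1 : rowSum (fun p q => k q p) = fun x => u ((g : X ≃ₜ X) x) := by
    ext p
    rw [rowSum, finsum_eq_single _ ((g : X ≃ₜ X) p) fun q hq => if_neg hq.symm]
    exact if_pos rfl
  have h2 : rowSum k = u := by
    ext p
    rw [rowSum, finsum_eq_single _ ((g : X ≃ₜ X).symm p)]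
    · simp [k]
    · intro q hq
      refine if_neg fun h => hq ?_
      rw [← h, Homeomorph.symm_apply_apply]
  have := neg_mem (hk.rowSum_transpose_sub_mem hT)
  rwa [neg_sub, h1, h2] at this

theorem rowSum_comp_sub_mem [CompactSpace X] (hT : IsAperiodic T) {k : X → X → ZMod 2}
    (hk : IsOrbital T k) (g : topologicalFullGroup T) :
    rowSum (fun p q => k ((g : X ≃ₜ X) p) ((g : X ≃ₜ X) q)) - rowSum k ∈ coboundaries T := by
  have h : rowSum (fun p q => k ((g : X ≃ₜ X) p) ((g : X ≃ₜ X) q)) =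
      fun p => rowSum k ((g : X ≃ₜ X) p) := by
    ext p
    exact finsum_comp_equiv (g : X ≃ₜ X).toEquiv (f := fun q => k ((g : X ≃ₜ X) p) q)
  rw [h]
  exact comp_sub_mem_coboundaries hT (hk.continuous_rowSum hT) g

/-! ### Inversions along orbits and the sign homomorphism -/

/-- The order of the orbits of `T`. -/
def OrbitLT (T : X ≃ₜ X) (p q : X) : Prop := ∃ n : ℤ, 0 < n ∧ q = (T ^ n) p

theorem IsAperiodic.orbitLT_zpow_iff (hT : IsAperiodic T) {x : X} {m n : ℤ} :
    OrbitLT T ((T ^ m) x) ((T ^ n) x) ↔ m < n := by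
  constructor
  · rintro ⟨k, hk, h⟩
    rw [← zpow_add_apply] at h
    have := hT.eq_of_zpow_eq h
    omega
  · intro h
    exact ⟨n - m, by omega, by rw [← zpow_add_apply]; simp⟩

theorem IsAperiodic.orbitLT_zpow_right_iff (hT : IsAperiodic T) {x : X} {n : ℤ} :
    OrbitLT T x ((T ^ n) x) ↔ 0 < n := by
  simpa using hT.orbitLT_zpow_iff (x := x) (m := 0) (n := n)

theorem IsAperiodic.orbitLT_zpow_left_iff (hT : IsAperiodic T) {x : X} {n : ℤ} :
    OrbitLT T ((T ^ n) x) x ↔ n < 0 := by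
  simpa using hT.orbitLT_zpow_iff (x := x) (m := n) (n := 0)

/-- Such a kernel is `e` plus its transpose, where `e` is the part above the diagonal. Modulo
coboundaries its row sum is twice that of `e`, hence zero mod 2. -/
theorem rowSum_mem_of_symmetric (hT : IsAperiodic T) {d : X → X → ZMod 2} (hd : IsOrbital T d)
    (hsymm : ∀ p q, d p q = d q p) (hdiag : ∀ p, d p p = 0) :
    rowSum d ∈ coboundaries T := by
  classical
  let e : X → X → ZMod 2 := fun p q => if OrbitLT T p q then d p q else 0
  have he : IsOrbital T e := by
    obtain ⟨⟨M, hM⟩, hc⟩ := hd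
    refine ⟨⟨M, fun p q h => hM p q fun h' => h ?_⟩, fun n => ?_⟩
    · simp [e, h']
    · by_cases hn : 0 < n
      · simpa only [e, hT.orbitLT_zpow_right_iff, if_pos hn] using hc n
      · simpa only [e, hT.orbitLT_zpow_right_iff, if_neg hn] using continuous_const
  have hde : d = e + fun p q => e q p := by
    ext p q
    by_cases h : d p q = 0
    · simp [e, h, ← hsymm p q]
    · obtain ⟨⟨M, hM⟩, -⟩ := hd
      obtain ⟨n, -, rfl⟩ := hM p q h
      have hn : n ≠ 0 := by
        rintro rfl
        exact h (by simpa using hdiag p)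
      simp only [e, Pi.add_apply, hT.orbitLT_zpow_right_iff, hT.orbitLT_zpow_left_iff]
      rcases lt_or_gt_of_ne hn with hn | hn
      · rw [if_neg (by omega), if_pos hn, zero_add, hsymm]
      · rw [if_pos hn, if_neg (by omega), add_zero]
  rw [hde, he.rowSum_add he.transpose]
  convert he.rowSum_transpose_sub_mem hT using 1
  ext p
  simp only [Pi.add_apply, Pi.sub_apply, CharTwo.sub_eq_add, add_comm]

open scoped Classical in
/-- The kernel indicating the pairs whose order is reversed by `g`. -/
noncomputable def inversionKernel (T g : X ≃ₜ X) (p q : X) : ZMod 2 :=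
  if OrbitLT T p q ∧ OrbitLT T (g q) (g p) then 1 else 0

theorem IsAperiodic.inversionKernel_eq (hT : IsAperiodic T) {g : X ≃ₜ X} {p q x : X}
    {m n a b : ℤ} (hp : p = (T ^ m) x) (hq : q = (T ^ n) x) (ha : g p = (T ^ a) x)
    (hb : g q = (T ^ b) x) :
    inversionKernel T g p q = if m < n ∧ b < a then 1 else 0 := by
  classical
  unfold inversionKernel
  refine if_congr ?_ rfl rfl
  rw [ha, hb, hp, hq, hT.orbitLT_zpow_iff, hT.orbitLT_zpow_iff]

theorem isOrbital_inversionKernel [CompactSpace X] (hT : IsAperiodic T)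
    (g : topologicalFullGroup T) : IsOrbital T (inversionKernel T g) := by
  classical
  obtain ⟨f, hf, hg, N, hN⟩ := exists_cocycle g
  have key : ∀ p (n : ℤ), OrbitLT T ((g : X ≃ₜ X) ((T ^ n) p)) ((g : X ≃ₜ X) p) ↔
      f ((T ^ n) p) + n < f p := by
    intro p n
    rw [hg, hg, ← zpow_add_apply, hT.orbitLT_zpow_iff]
  refine ⟨⟨2 * N, fun p q h => ?_⟩, fun n => ?_⟩
  · have h1 : OrbitLT T p q ∧ OrbitLT T ((g : X ≃ₜ X) q) ((g : X ≃ₜ X) p) := by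
      by_contra h1
      exact h (if_neg h1)
    obtain ⟨⟨n, hn, rfl⟩, h2⟩ := h1
    rw [key] at h2
    refine ⟨n, ?_, rfl⟩
    have := abs_le.1 (hN p)
    have := abs_le.1 (hN ((T ^ n) p))
    rw [abs_le]
    push_cast
    omega
  · have h : (fun p => inversionKernel T g p ((T ^ n) p)) =
        (fun a : ℤ × ℤ => if 0 < n ∧ a.1 + n < a.2 then 1 else 0) ∘
          fun p => (f ((T ^ n) p), f p) := by
      ext p
      simp only [inversionKernel, hT.orbitLT_zpow_right_iff, key, Function.comp_apply]
    rw [h]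
    exact continuous_of_discreteTopology.comp ((hf.comp (T ^ n).continuous).prodMk hf)

/-- As for finite permutations, `g * h` reverses an unordered pair iff exactly one of `h` on the
pair and `g` on its image does. For ordered pairs this identity holds up to a symmetric kernel with
zero diagonal, and pulling back by `h` changes row sums by a coboundary. -/
theorem rowSum_inversionKernel_mul [CompactSpace X] (hT : IsAperiodic T)
    (g h : topologicalFullGroup T) :
    rowSum (inversionKernel T (g * h : topologicalFullGroup T)) -
      (rowSum (inversionKernel T g) + rowSum (inversionKernel T h)) ∈ coboundaries T := by
  have hg := isOrbital_inversionKernel hT g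
  have hh := isOrbital_inversionKernel hT h
  have hgh := isOrbital_inversionKernel hT (g * h)
  have h1 := rowSum_comp_sub_mem hT hg h
  have hd := (hgh.sub hh).sub (hg.comp h)
  have h2 := rowSum_mem_of_symmetric hT hd ?_ ?_
  · rw [(hgh.sub hh).rowSum_sub (hg.comp h), hgh.rowSum_sub hh] at h2
    convert add_mem h2 h1 using 1
    abel
  · intro p q
    -- On one orbit, symmetry is a check of the possible orders of the two points, of their images
    -- under `h` and of those under `g * h`; off a common orbit everything vanishes.
    by_cases hpq : ∃ n : ℤ, q = (T ^ n) p
    · obtain ⟨n, rfl⟩ := hpq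
      obtain ⟨a, -, ha⟩ := h.2
      obtain ⟨b, -, hb⟩ := (g * h).2
      have ha' : a ((T ^ n) p) + n = a p → n = 0 := fun h' => by
        refine hT p n ((h : X ≃ₜ X).injective ?_)
        rw [ha, ha, ← zpow_add_apply, h']
      have hb' : b ((T ^ n) p) + n = b p → n = 0 := fun h' => by
        refine hT p n (((g * h : topologicalFullGroup T) : X ≃ₜ X).injective ?_)
        rw [hb, hb, ← zpow_add_apply, h']
      have e0 : p = (T ^ (0 : ℤ)) p := by simp
      have e1 := ha ((T ^ n) p)
      have e2 := hb ((T ^ n) p)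
      rw [← zpow_add_apply] at e1 e2
      simp only [Pi.sub_apply]
      rw [hT.inversionKernel_eq e0 rfl (hb p) e2, hT.inversionKernel_eq rfl e0 e2 (hb p),
        hT.inversionKernel_eq e0 rfl (ha p) e1, hT.inversionKernel_eq rfl e0 e1 (ha p),
        hT.inversionKernel_eq (ha p) e1 (hb p) e2, hT.inversionKernel_eq e1 (ha p) e2 (hb p)]
      generalize a ((T ^ n) p) + n = a' at *
      generalize b ((T ^ n) p) + n = b' at *
      rcases lt_trichotomy n 0 with hn | hn | hn
      · rcases lt_or_gt_of_ne (fun h' => hn.ne (ha' h')) with h1 | h1 <;>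
          rcases lt_or_gt_of_ne (fun h' => hn.ne (hb' h')) with h2 | h2 <;>
          simp [hn, h1, h2, hn.not_gt, h1.not_gt, h2.not_gt]
      · subst hn
        rw [show ((T ^ (0 : ℤ)) p) = p by simp] at e1 e2
        rw [hT.eq_of_zpow_eq (e1.symm.trans (ha p)), hT.eq_of_zpow_eq (e2.symm.trans (hb p))]
      · rcases lt_or_gt_of_ne (fun h' => hn.ne' (ha' h')) with h1 | h1 <;>
          rcases lt_or_gt_of_ne (fun h' => hn.ne' (hb' h')) with h2 | h2 <;>
          simp [hn, h1, h2, hn.not_gt, h1.not_gt, h2.not_gt]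
    · have h0 : ∀ k : X → X → ZMod 2, IsOrbital T k → k p q = 0 ∧ k q p = 0 := by
        intro k hk
        obtain ⟨⟨M, hM⟩, -⟩ := hk
        refine ⟨by_contra fun h' => ?_, by_contra fun h' => ?_⟩
        · obtain ⟨n, -, hn⟩ := hM _ _ h'
          exact hpq ⟨n, hn⟩
        · obtain ⟨n, -, hn⟩ := hM _ _ h'
          exact hpq ⟨-n, eq_zpow_neg_apply hn⟩
      rw [(h0 _ hd).1, (h0 _ hd).2]
  · intro p
    have h0 : ∀ x, ¬ OrbitLT T x x := fun x hx => by
      have := hT.orbitLT_zpow_iff (x := x) (m := 0) (n := 0)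
      simp at this
      exact this hx
    simp [inversionKernel, h0]

/-- The sign of an element of the topological full group. -/
noncomputable def orbitSign [CompactSpace X] (hT : IsAperiodic T) :
    topologicalFullGroup T →* Multiplicative ((X → ZMod 2) ⧸ coboundaries T) :=
  MonoidHom.mk' (fun g => .ofAdd (QuotientAddGroup.mk (rowSum (inversionKernel T g)))) fun g h => by
    rw [← ofAdd_add, ← QuotientAddGroup.mk_add]
    refine congrArg _ ((QuotientAddGroup.eq_iff_sub_mem).2 (rowSum_inversionKernel_mul hT g h))

theorem rowSum_inversionKernel_mem [CompactSpace X] (hT : IsAperiodic T)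
    {g : topologicalFullGroup T} (hg : g ∈ commutator (topologicalFullGroup T)) :
    rowSum (inversionKernel T g) ∈ coboundaries T := by
  have h := Abelianization.commutator_subset_ker (orbitSign hT) hg
  rw [MonoidHom.mem_ker] at h
  exact (QuotientAddGroup.eq_zero_iff _).1 h

end TopFullGroup

/-! ### The index homomorphism -/

namespace TopFullGroup

variable {X : Type*} [TopologicalSpace X] {T : X ≃ₜ X}

open scoped Classical in
/-- The indicator function of the forward orbit of `w`. -/
noncomputable def forwardIndicator (T : X ≃ₜ X) (w y : X) : ℤ :=
  if ∃ n : ℤ, 0 ≤ n ∧ y = (T ^ n) w then 1 else 0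

theorem IsAperiodic.forwardIndicator_zpow (hT : IsAperiodic T) (w : X) (n : ℤ) :
    forwardIndicator T w ((T ^ n) w) = if 0 ≤ n then 1 else 0 := by
  classical
  unfold forwardIndicator
  refine if_congr ⟨?_, fun h => ⟨n, h, rfl⟩⟩ rfl rfl
  rintro ⟨m, hm, h⟩
  rwa [hT.eq_of_zpow_eq h]

theorem forwardIndicator_of_notMem {w y : X} (h : ∀ n : ℤ, y ≠ (T ^ n) w) :
    forwardIndicator T w y = 0 := by
  classical
  exact if_neg fun ⟨n, _, hn⟩ => h n hn

/-- An element of the topological full group moves finitely many points across the ends of a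
forward orbit. -/
theorem forwardIndicator_sub_support (hT : IsAperiodic T) (w : X) {g : X ≃ₜ X} {f : X → ℤ}
    (hg : ∀ x, g x = (T ^ f x) x) {N : ℕ} (hN : ∀ x, |f x| ≤ N) :
    Function.support (fun y => forwardIndicator T w (g y) - forwardIndicator T w y) ⊆
      (fun n : ℤ => (T ^ n) w) '' Set.Ico (-(N : ℤ)) N := by
  intro y hy
  by_cases h : ∃ n : ℤ, y = (T ^ n) w
  · obtain ⟨n, rfl⟩ := h
    refine ⟨n, ?_, rfl⟩
    by_contra hn
    refine hy ?_
    have := abs_le.1 (hN ((T ^ n) w))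
    simp only [hg, ← zpow_add_apply, hT.forwardIndicator_zpow]
    rw [Set.mem_Ico, not_and_or] at hn
    split_ifs <;> omega
  · push Not at h
    refine absurd ?_ hy
    have h' : ∀ n : ℤ, g y ≠ (T ^ n) w := by
      intro n hn
      rw [hg] at hn
      refine h (-f y + n) ?_
      rw [zpow_add_apply, ← hn, zpow_neg_apply_zpow]
    simp [forwardIndicator_of_notMem h, forwardIndicator_of_notMem h']

/-- The index of an element of the topological full group. -/
noncomputable def orbitIndex [CompactSpace X] (hT : IsAperiodic T) (w : X) :
    topologicalFullGroup T →* Multiplicative ℤ :=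
  MonoidHom.mk' (fun g => .ofAdd (∑ᶠ y, (forwardIndicator T w ((g : X ≃ₜ X) y) -
    forwardIndicator T w y))) fun g h => by
    have hfin : ∀ g : topologicalFullGroup T, (Function.support fun y =>
        forwardIndicator T w ((g : X ≃ₜ X) y) - forwardIndicator T w y).Finite := by
      intro g
      obtain ⟨f, -, hg, N, hN⟩ := exists_cocycle g
      exact ((Set.finite_Ico _ _).image _).subset (forwardIndicator_sub_support hT w hg hN)
    have hreindex := finsum_comp_equiv (h : X ≃ₜ X).toEquiv
      (f := fun y => forwardIndicator T w ((g : X ≃ₜ X) y) - forwardIndicator T w y)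
    rw [← ofAdd_add, ← hreindex, ← finsum_add_distrib _ (hfin h)]
    · refine congrArg _ (finsum_congr fun y => ?_)
      simp
    · exact (hfin g).preimage (h : X ≃ₜ X).injective.injOn

theorem sum_forwardIndicator_sub_eq_zero [CompactSpace X] (hT : IsAperiodic T) (w : X)
    {g : topologicalFullGroup T} (hg : g ∈ commutator (topologicalFullGroup T)) {f : X → ℤ}
    (hf : ∀ x, (g : X ≃ₜ X) x = (T ^ f x) x) {N : ℕ} (hN : ∀ x, |f x| ≤ N) :
    -- `Fin (2 * N)` shifted by `-N` is the window `[-N, N)`, outside which displacements of at most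
    -- `N` cross no end.
    ∑ k : Fin (2 * N), (forwardIndicator T w ((g : X ≃ₜ X) ((T ^ ((k : ℤ) - N)) w)) -
      forwardIndicator T w ((T ^ ((k : ℤ) - N)) w)) = 0 := by
  classical
  have h := Abelianization.commutator_subset_ker (orbitIndex hT w) hg
  rw [MonoidHom.mem_ker] at h
  have h' : (∑ᶠ y, (forwardIndicator T w ((g : X ≃ₜ X) y) - forwardIndicator T w y)) = 0 := h
  rw [finsum_eq_sum_of_support_subset (s := Finset.univ.image
    fun k : Fin (2 * N) => (T ^ ((k : ℤ) - N)) w), Finset.sum_image] at h'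
  · exact h'
  · intro a _ b _ hab
    have := hT.eq_of_zpow_eq hab
    exact Fin.ext (by omega)
  · intro y hy
    obtain ⟨n, ⟨h1, h2⟩, rfl⟩ := forwardIndicator_sub_support hT w hf hN hy
    simp only [Finset.coe_image, Finset.coe_univ, Set.image_univ, Set.mem_range]
    refine ⟨⟨(n + N).toNat, by omega⟩, ?_⟩
    congr 2
    simp only
    omega

/-! ### Towers over a clopen base and the elements permuting their levels -/

/-- The action of the topological full group by permutations. -/
def toPerm (T : X ≃ₜ X) : topologicalFullGroup T →* Equiv.Perm X where
  toFun g := (g : X ≃ₜ X).toEquiv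
  map_one' := rfl
  map_mul' _ _ := rfl

theorem toPerm_injective : Function.Injective (toPerm T) := fun _ _ h =>
  Subtype.ext (Homeomorph.toEquiv_injective h)

theorem exists_toPerm_eq [CompactSpace X] [T2Space X] (S : Equiv.Perm X) (f : X → ℤ)
    (hf : Continuous f) (hS : ∀ x, S x = (T ^ f x) x) :
    ∃ g : topologicalFullGroup T, toPerm T g = S := by
  have hc : Continuous S := by
    have hc : Continuous fun a : ℤ × X => (T ^ a.1) a.2 :=
      continuous_prod_of_discrete_left.2 fun n => (T ^ n).continuous
    rw [show ⇑S = (fun a : ℤ × X => (T ^ a.1) a.2) ∘ fun x => (f x, x) from funext hS]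
    exact hc.comp (hf.prodMk continuous_id)
  exact ⟨⟨hc.homeoOfEquivCompactToT2, f, hf, hS⟩, Equiv.ext fun _ => rfl⟩

/-- A clopen set to which every point returns in the past and in the future. -/
structure Base (T : X ≃ₜ X) where
  /-- The underlying set. -/
  carrier : Set X
  isClopen : IsClopen carrier
  exists_forward : ∀ x, ∃ n : ℕ, 0 < n ∧ (T ^ (n : ℤ)) x ∈ carrier
  exists_backward : ∀ x, ∃ n : ℕ, (T ^ (-(n : ℤ))) x ∈ carrier

namespace Base

variable (B : Base T)

open scoped Classical in
/-- The time of the first return to the base. -/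
noncomputable def returnTime (x : X) : ℕ := Nat.find (B.exists_forward x)

theorem returnTime_pos (x : X) : 0 < B.returnTime x := by
  classical
  exact (Nat.find_spec (B.exists_forward x)).1

theorem zpow_returnTime_mem (x : X) : (T ^ (B.returnTime x : ℤ)) x ∈ B.carrier := by
  classical
  exact (Nat.find_spec (B.exists_forward x)).2

theorem returnTime_le {x : X} {n : ℤ} (hn : 0 < n) (h : (T ^ n) x ∈ B.carrier) :
    (B.returnTime x : ℤ) ≤ n := by
  classical
  lift n to ℕ using hn.le
  exact_mod_cast Nat.find_min' (B.exists_forward x) ⟨by exact_mod_cast hn, h⟩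

theorem isLocallyConstant_returnTime : IsLocallyConstant B.returnTime := by
  rw [IsLocallyConstant.iff_eventually_eq]
  intro x
  have h : ∀ᶠ y in nhds x, ∀ j ∈ Finset.range (B.returnTime x + 1),
      ((T ^ (j : ℤ)) y ∈ B.carrier ↔ (T ^ (j : ℤ)) x ∈ B.carrier) := by
    rw [Filter.eventually_all_finset]
    intro j _
    have hU := B.isClopen.preimage (T ^ (j : ℤ)).continuous
    by_cases hx : (T ^ (j : ℤ)) x ∈ B.carrier
    · filter_upwards [hU.isOpen.mem_nhds hx] with y hy
      exact iff_of_true hy hx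
    · filter_upwards [hU.compl.isOpen.mem_nhds hx] with y hy
      exact iff_of_false hy hx
  filter_upwards [h] with y hy
  have h1 : B.returnTime y ≤ B.returnTime x := by
    have := B.returnTime_le (x := y) (n := B.returnTime x) (by exact_mod_cast B.returnTime_pos x)
      ((hy _ (by simp)).2 (B.zpow_returnTime_mem x))
    exact_mod_cast this
  have h2 : B.returnTime x ≤ B.returnTime y := by
    have := B.returnTime_le (x := x) (n := B.returnTime y) (by exact_mod_cast B.returnTime_pos y)
      ((hy _ (by simp; omega)).1 (B.zpow_returnTime_mem y))
    exact_mod_cast this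
  omega

/-- The decomposition of the space into the levels of the towers over the base. -/
noncomputable def towerEquiv : (Σ z : B.carrier, Fin (B.returnTime z)) ≃ X := by
  refine Equiv.ofBijective (fun a => (T ^ (a.2 : ℤ)) a.1) ⟨?_, ?_⟩
  · have key : ∀ (z z' : B.carrier) (k : Fin (B.returnTime z)) (l : Fin (B.returnTime z')),
        (T ^ (k : ℤ)) (z : X) = (T ^ (l : ℤ)) (z' : X) → (l : ℕ) ≤ k := by
      intro z z' k l h
      by_contra! hlt
      have h1 : (T ^ ((l : ℤ) - k)) (z' : X) ∈ B.carrier := by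
        rw [sub_eq_neg_add, zpow_add_apply, ← h, zpow_neg_apply_zpow]
        exact z.2
      have := B.returnTime_le (by omega) h1
      omega
    rintro ⟨z, k⟩ ⟨z', l⟩ h
    have hkl : (k : ℕ) = l := le_antisymm (key z' z l k h.symm) (key z z' k l h)
    have hz : z = z' := by
      simp only [hkl] at h
      exact Subtype.ext ((T ^ (l : ℤ)).injective h)
    subst hz
    rw [Fin.ext hkl]
  · intro y
    classical
    let k := Nat.find (B.exists_backward y)
    have hk := Nat.find_spec (B.exists_backward y)
    refine ⟨⟨⟨_, hk⟩, ⟨k, ?_⟩⟩, zpow_apply_zpow_neg T _ y⟩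
    by_contra! hle
    have h1 := B.zpow_returnTime_mem ((T ^ (-(k : ℤ))) y)
    have h0 := B.returnTime_pos ((T ^ (-(k : ℤ))) y)
    set r := B.returnTime ((T ^ (-(k : ℤ))) y)
    rw [← zpow_add_apply] at h1
    refine Nat.find_min (B.exists_backward y) (m := k - r) (by omega) ?_
    change r ≤ k at hle
    convert h1 using 3
    omega

theorem towerEquiv_apply (z : B.carrier) (k : Fin (B.returnTime z)) :
    B.towerEquiv ⟨z, k⟩ = (T ^ (k : ℤ)) z := rfl

theorem exists_eq_zpow (y : X) :
    ∃ (z : B.carrier) (k : Fin (B.returnTime z)), y = (T ^ (k : ℤ)) z :=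
  ⟨(B.towerEquiv.symm y).1, (B.towerEquiv.symm y).2, (B.towerEquiv.apply_symm_apply y).symm⟩

/-- A family of permutations of the towers acts on the space. -/
noncomputable def towerPerm : (∀ z : B.carrier, Equiv.Perm (Fin (B.returnTime z))) →*
    Equiv.Perm X :=
  B.towerEquiv.permCongrHom.toMonoidHom.comp
    (Equiv.Perm.sigmaCongrRightHom fun z : B.carrier => Fin (B.returnTime z))

theorem towerPerm_apply (α : ∀ z : B.carrier, Equiv.Perm (Fin (B.returnTime z))) (z : B.carrier)
    (k : Fin (B.returnTime z)) :
    B.towerPerm α ((T ^ (k : ℤ)) z) = (T ^ (α z k : ℤ)) z := by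
  rw [← towerEquiv_apply, ← towerEquiv_apply]
  simp [towerPerm, Equiv.permCongrHom]

/-- A family of permutations of the towers together with their heights. -/
noncomputable def code (α : ∀ z : B.carrier, Equiv.Perm (Fin (B.returnTime z))) (z : B.carrier) :
    Σ n, Equiv.Perm (Fin n) := ⟨B.returnTime z, α z⟩

theorem _root_.Equiv.Perm.sigma_fin_eq {n m : ℕ} {σ : Equiv.Perm (Fin n)} {τ : Equiv.Perm (Fin m)}
    (h : n = m) (hστ : ∀ k (hk : k < n) (hk' : k < m), (σ ⟨k, hk⟩ : ℕ) = τ ⟨k, hk'⟩) :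
    (⟨n, σ⟩ : Σ n, Equiv.Perm (Fin n)) = ⟨m, τ⟩ := by
  subst h
  congr 1
  ext ⟨k, hk⟩
  exact hστ k hk hk

theorem _root_.Equiv.Perm.apply_eq_of_sigma_fin_eq {n m : ℕ} {σ : Equiv.Perm (Fin n)}
    {τ : Equiv.Perm (Fin m)} (h : (⟨n, σ⟩ : Σ n, Equiv.Perm (Fin n)) = ⟨m, τ⟩) :
    n = m ∧ ∀ k (hk : k < n) (hk' : k < m), (σ ⟨k, hk⟩ : ℕ) = τ ⟨k, hk'⟩ := by
  cases h
  exact ⟨rfl, fun _ _ _ => rfl⟩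

theorem exists_toPerm_eq_towerPerm [CompactSpace X] [T2Space X]
    {α : ∀ z : B.carrier, Equiv.Perm (Fin (B.returnTime z))}
    (hα : IsLocallyConstant (B.code α)) :
    ∃ g : topologicalFullGroup T, toPerm T g = B.towerPerm α := by
  let d : (Σ z : B.carrier, Fin (B.returnTime z)) → ℤ := fun a => (α a.1 a.2 : ℤ) - a.2
  refine exists_toPerm_eq _ (fun y => d (B.towerEquiv.symm y)) ?_ fun y => ?_
  · refine IsLocallyConstant.continuous ((IsLocallyConstant.iff_eventually_eq _).2 fun y => ?_)
    obtain ⟨z, k, rfl⟩ := B.exists_eq_zpow y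
    obtain ⟨V, hV, hVz⟩ := isOpen_induced_iff.1 (hα.isOpen_fiber (B.code α z))
    have hz : z ∈ Subtype.val ⁻¹' V := hVz ▸ rfl
    have hc := (T ^ (-(k : ℤ))).continuous.continuousAt (x := (T ^ (k : ℤ)) (z : X))
    have hmem : V ∩ B.carrier ∈ nhds ((T ^ (-(k : ℤ))) ((T ^ (k : ℤ)) (z : X))) := by
      rw [zpow_neg_apply_zpow]
      exact (hV.inter B.isClopen.isOpen).mem_nhds ⟨hz, z.2⟩
    filter_upwards [hc hmem] with x hx
    obtain ⟨z', hz', rfl⟩ : ∃ z' : B.carrier, (z' : X) ∈ V ∧ x = (T ^ (k : ℤ)) z' :=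
      ⟨⟨_, hx.2⟩, hx.1, (zpow_apply_zpow_neg T _ x).symm⟩
    have hcode : B.code α z' = B.code α z := by
      have : z' ∈ Subtype.val ⁻¹' V := hz'
      rw [hVz] at this
      exact this
    obtain ⟨h1, h2⟩ := Equiv.Perm.apply_eq_of_sigma_fin_eq hcode
    have hk : (k : ℕ) < B.returnTime z' := by rw [h1]; exact k.2
    have e1 : (T ^ (k : ℤ)) (z' : X) = B.towerEquiv ⟨z', ⟨k, hk⟩⟩ := rfl
    have e2 : (T ^ (k : ℤ)) (z : X) = B.towerEquiv ⟨z, k⟩ := rfl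
    rw [e1, e2, Equiv.symm_apply_apply, Equiv.symm_apply_apply]
    simp only [d, h2 k hk k.2]
  · obtain ⟨z, k, rfl⟩ := B.exists_eq_zpow y
    have hd : d (B.towerEquiv.symm ((T ^ (k : ℤ)) z)) = (α z k : ℤ) - k := by
      rw [← B.towerEquiv_apply, Equiv.symm_apply_apply]
    rw [B.towerPerm_apply, ← zpow_add_apply, hd, sub_add_cancel]

/-- The factorisation of an even permutation is chosen once for each height and permutation, so the
factors are again locally constant along the base and define elements of the full group. -/
theorem isSqOneMulConj_of_toPerm_eq [CompactSpace X] [T2Space X]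
    {α : ∀ z : B.carrier, Equiv.Perm (Fin (B.returnTime z))}
    (hα : IsLocallyConstant (B.code α)) (hsign : ∀ z, Equiv.Perm.sign (α z) = 1)
    {g : topologicalFullGroup T} (hg : toPerm T g = B.towerPerm α) : IsSqOneMulConj g := by
  -- Evenness sits inside the existential, so that the chosen `s` and `h` are functions of `n` and
  -- `σ` alone.
  have h : ∀ n (σ : Equiv.Perm (Fin n)), ∃ s h : Equiv.Perm (Fin n), Equiv.Perm.sign σ = 1 →
      s * s = 1 ∧ σ = s * (h * s * h⁻¹) := by
    intro n σ
    by_cases hσ : Equiv.Perm.sign σ = 1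
    · obtain ⟨s, h, hsh⟩ := σ.isSqOneMulConj_of_sign_eq_one hσ
      exact ⟨s, h, fun _ => hsh⟩
    · exact ⟨1, 1, fun h => absurd h hσ⟩
  choose s h hsh using h
  obtain ⟨a, ha⟩ := B.exists_toPerm_eq_towerPerm (α := fun z => s _ (α z))
    (hα.comp fun c : Σ n, Equiv.Perm (Fin n) =>
      (⟨c.1, s c.1 c.2⟩ : Σ n, Equiv.Perm (Fin n)))
  obtain ⟨b, hb⟩ := B.exists_toPerm_eq_towerPerm (α := fun z => h _ (α z))
    (hα.comp fun c : Σ n, Equiv.Perm (Fin n) =>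
      (⟨c.1, h c.1 c.2⟩ : Σ n, Equiv.Perm (Fin n)))
  refine ⟨a, b, toPerm_injective ?_, toPerm_injective ?_⟩
  · rw [map_mul, map_one, ha, ← map_mul, ← map_one B.towerPerm]
    exact congrArg _ (funext fun z => (hsh _ _ (hsign z)).1)
  · simp only [map_mul, map_inv]
    rw [ha, hb, hg, ← map_inv, ← map_mul, ← map_mul, ← map_mul]
    exact congrArg _ (funext fun z => (hsh _ _ (hsign z)).2)

end Base

end TopFullGroup

/-! ### Parity by counting inversions, and even permutations between subsets -/

theorem Equiv.Perm.sign_eq_one_of_sum_eq_zero {n : ℕ} {σ : Equiv.Perm (Fin n)}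
    (h : ∑ i, ∑ j ∈ Finset.Ioi i, (if σ j < σ i then (1 : ZMod 2) else 0) = 0) :
    Equiv.Perm.sign σ = 1 := by
  have h1 : Equiv.Perm.sign σ =
      (-1) ^ (∑ i, ∑ j ∈ Finset.Ioi i, if σ j < σ i then 1 else 0) := by
    rw [σ.sign_eq_prod_prod_Ioi, ← Finset.prod_pow_eq_pow_sum]
    refine Finset.prod_congr rfl fun i _ => ?_
    rw [← Finset.prod_pow_eq_pow_sum]
    refine Finset.prod_congr rfl fun j hj => ?_
    have hne : σ i ≠ σ j := σ.injective.ne (Finset.mem_Ioi.1 hj).ne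
    rcases lt_or_gt_of_ne hne with h | h
    · simp [h, h.not_gt]
    · simp [h, h.not_gt]
  rw [h1]
  refine Even.neg_one_pow ?_
  rw [even_iff_two_dvd, ← ZMod.natCast_eq_zero_iff]
  push_cast
  exact h

/-- An even permutation carrying one subset onto another one of the same size. -/
theorem Equiv.Perm.exists_sign_eq_one_iff {α : Type*} [Fintype α] [DecidableEq α]
    (p q : α → Prop) [DecidablePred p] [DecidablePred q]
    (hpq : Fintype.card {x // p x} = Fintype.card {x // q x}) {a b : α} (hab : a ≠ b)
    (ha : p a) (hb : p b) :
    ∃ γ : Equiv.Perm α, Equiv.Perm.sign γ = 1 ∧ ∀ k, q (γ k) ↔ p k := by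
  obtain ⟨e⟩ := Fintype.card_eq.1 hpq
  have he : ∀ k, q (e.extendSubtype k) ↔ p k := fun k =>
    ⟨fun h => by_contra fun hk => e.extendSubtype_not_mem k hk h, e.extendSubtype_mem k⟩
  rcases Int.units_eq_one_or (Equiv.Perm.sign e.extendSubtype) with h | h
  · exact ⟨_, h, he⟩
  · refine ⟨e.extendSubtype * Equiv.swap a b, by simp [h, Equiv.Perm.sign_swap hab], fun k => ?_⟩
    rw [Equiv.Perm.mul_apply, he]
    by_cases h1 : k = a
    · simp [h1, ha, hb]
    by_cases h2 : k = b
    · simp [h2, ha, hb]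
    rw [Equiv.swap_apply_of_ne_of_ne h1 h2]

/-! ### Bases in minimal systems and elements preserving half orbits -/

namespace TopFullGroup

variable {X : Type*} [TopologicalSpace X] {T : X ≃ₜ X}

theorem _root_.IsMinimalHomeo.isAperiodic [T1Space X] [Infinite X] (hmin : IsMinimalHomeo T) :
    IsAperiodic T := by
  intro x n hx
  by_contra hn
  have hm : ∀ m : ℤ, (T ^ (n * m)) x = x := by
    intro m
    induction m using Int.induction_on with
    | zero => simp
    | succ m ih => rw [mul_add, mul_one, zpow_add_apply, hx, ih]
    | pred m ih =>
      have := eq_zpow_neg_apply hx.symm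
      rw [mul_sub, mul_one, sub_eq_add_neg, zpow_add_apply, ← this, ih]
  have hfin : (Set.range fun k : ℤ => (T ^ k) x).Finite := by
    refine ((Set.finite_Ico 0 |n|).image fun k => (T ^ k) x).subset ?_
    rintro _ ⟨k, rfl⟩
    refine ⟨k % n, ⟨Int.emod_nonneg k hn, Int.emod_lt_abs k hn⟩, ?_⟩
    simp only
    conv_rhs => rw [← Int.emod_add_mul_ediv k n, zpow_add_apply, hm]
  have := hfin.isClosed.closure_eq
  rw [(hmin x).closure_eq] at this
  exact Set.infinite_univ (this ▸ hfin)

theorem _root_.IsMinimalHomeo.exists_base [CompactSpace X] (hmin : IsMinimalHomeo T) {U : Set X}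
    (hU : IsClopen U) (hne : U.Nonempty) : ∃ B : Base T, B.carrier = U := by
  obtain ⟨t, ht⟩ := isCompact_univ.elim_finite_subcover
    (fun n : ℤ => (T ^ n) ⁻¹' U) (fun n => hU.isOpen.preimage (T ^ n).continuous) (by
      intro x _
      obtain ⟨_, hn, ⟨n, rfl⟩⟩ := (hmin x).inter_open_nonempty U hU.isOpen hne
      exact Set.mem_iUnion.2 ⟨n, hn⟩)
  have hM : ∀ x, ∃ n : ℤ, |n| ≤ (t.sup Int.natAbs : ℕ) ∧ (T ^ n) x ∈ U := by
    intro x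
    obtain ⟨n, hn, hx⟩ := Set.mem_iUnion₂.1 (ht (Set.mem_univ x))
    refine ⟨n, ?_, hx⟩
    rw [Int.abs_eq_natAbs]
    exact_mod_cast Finset.le_sup (f := Int.natAbs) hn
  generalize t.sup Int.natAbs = M at hM
  refine ⟨⟨U, hU, fun x => ?_, fun x => ?_⟩, rfl⟩
  · obtain ⟨n, h1, h2⟩ := hM ((T ^ ((M : ℤ) + 1)) x)
    rw [← zpow_add_apply] at h2
    have := abs_le.1 h1
    refine ⟨(n + (M + 1)).toNat, by omega, ?_⟩
    rwa [Int.toNat_of_nonneg (by omega)]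
  · obtain ⟨n, h1, h2⟩ := hM ((T ^ (-(M : ℤ))) x)
    rw [← zpow_add_apply] at h2
    have := abs_le.1 h1
    refine ⟨(-(n + -M)).toNat, ?_⟩
    rwa [Int.toNat_of_nonneg (by omega), neg_neg]

/-- By freeness `x` is separated from each `T ^ j x` with `0 < j < L` by a clopen set, and a finite
intersection excludes all these return times at once. -/
theorem _root_.IsMinimalHomeo.exists_base_le_returnTime [CompactSpace X] [T2Space X]
    [TotallyDisconnectedSpace X] (hmin : IsMinimalHomeo T) (hT : IsAperiodic T) (x : X) (L : ℕ) :
    ∃ B : Base T, x ∈ B.carrier ∧ ∀ z ∈ B.carrier, L ≤ B.returnTime z := by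
  have hV : ∀ j : ℕ, ∃ V : Set X, 0 < j → IsClopen V ∧ x ∈ V ∧ (T ^ (j : ℤ)) x ∉ V := by
    intro j
    by_cases hj : 0 < j
    · obtain ⟨V, h1, h2, h3⟩ := exists_isClopen_of_totally_separated
        (show x ≠ (T ^ (j : ℤ)) x from fun h => hj.ne' (by exact_mod_cast hT x j h.symm))
      exact ⟨V, fun _ => ⟨h1, h2, h3⟩⟩
    · exact ⟨∅, fun h => absurd h hj⟩
  choose V hV using hV
  obtain ⟨B, hB⟩ := hmin.exists_base
    (U := ⋂ j ∈ Finset.Ico 1 L, V j ∩ (T ^ (j : ℤ)) ⁻¹' (V j)ᶜ)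
    (isClopen_biInter_finset fun j hj => by
      have h := (hV j (Finset.mem_Ico.1 hj).1).1
      exact h.inter (h.compl.preimage (T ^ (j : ℤ)).continuous))
    ⟨x, Set.mem_iInter₂.2 fun j hj => (hV j (Finset.mem_Ico.1 hj).1).2⟩
  refine ⟨B, hB ▸ Set.mem_iInter₂.2 fun j hj => (hV j (Finset.mem_Ico.1 hj).1).2,
    fun z hz => ?_⟩
  by_contra! hlt
  have hj : B.returnTime z ∈ Finset.Ico 1 L := Finset.mem_Ico.2 ⟨B.returnTime_pos z, hlt⟩
  have h1 := B.zpow_returnTime_mem z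
  rw [hB] at h1 hz
  exact (Set.mem_iInter₂.1 hz _ hj).2 (Set.mem_iInter₂.1 h1 _ hj).1

/-- An element of the topological full group preserving the half orbits of the points of the base
permutes each tower. -/
theorem Base.exists_towerPerm_eq (hT : IsAperiodic T) (B : Base T) {g : topologicalFullGroup T}
    {f : X → ℤ} (hf : Continuous f) (hgf : ∀ x, (g : X ≃ₜ X) x = (T ^ f x) x)
    (hB : ∀ z ∈ B.carrier, ∀ n : ℤ, 0 ≤ n ↔ 0 ≤ n + f ((T ^ n) z)) :
    ∃ α : ∀ z : B.carrier, Equiv.Perm (Fin (B.returnTime z)),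
      (∀ z k, (α z k : ℤ) = k + f ((T ^ (k : ℤ)) z)) ∧ IsLocallyConstant (B.code α) ∧
        toPerm T g = B.towerPerm α := by
  have hrange : ∀ (z : B.carrier) (k : Fin (B.returnTime z)),
      0 ≤ k + f ((T ^ (k : ℤ)) z) ∧ k + f ((T ^ (k : ℤ)) z) < B.returnTime z := by
    intro z k
    refine ⟨(hB z z.2 k).1 (by omega), ?_⟩
    -- The lower bound comes from the half orbit of `z`, the upper bound from that of the next base
    -- point.
    have h := hB _ (B.zpow_returnTime_mem z) (k - B.returnTime z)
    rw [← zpow_add_apply, sub_add_cancel] at h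
    have := k.2
    omega
  let φ : ∀ z : B.carrier, Fin (B.returnTime z) → Fin (B.returnTime z) := fun z k =>
    ⟨(k + f ((T ^ (k : ℤ)) z)).toNat, by have := hrange z k; omega⟩
  have hφ : ∀ z k, (φ z k : ℤ) = k + f ((T ^ (k : ℤ)) z) := fun z k =>
    Int.toNat_of_nonneg (hrange z k).1
  have hinj : ∀ z, Function.Injective (φ z) := by
    intro z k l h
    have h1 : (φ z k : ℤ) = φ z l := by rw [h]
    rw [hφ, hφ] at h1
    have h2 : (g : X ≃ₜ X) ((T ^ (k : ℤ)) z) = (g : X ≃ₜ X) ((T ^ (l : ℤ)) z) := by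
      rw [hgf, hgf, ← zpow_add_apply, ← zpow_add_apply, add_comm, h1, add_comm]
    have := hT.eq_of_zpow_eq ((g : X ≃ₜ X).injective h2)
    exact Fin.ext (by exact_mod_cast this)
  have hα : ∀ z k, (Equiv.ofBijective (φ z) (Finite.injective_iff_bijective.1 (hinj z)) k : ℤ) =
      k + f ((T ^ (k : ℤ)) z) := hφ
  refine ⟨fun z => Equiv.ofBijective (φ z) (Finite.injective_iff_bijective.1 (hinj z)), hα,
    ?_, ?_⟩
  · rw [IsLocallyConstant.iff_eventually_eq]
    intro z
    have h1 : ∀ᶠ y : B.carrier in nhds z, B.returnTime (y : X) = B.returnTime z :=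
      ((IsLocallyConstant.iff_eventually_eq _).1
        (B.isLocallyConstant_returnTime.comp_continuous continuous_subtype_val)) z
    have h2 : ∀ᶠ y : B.carrier in nhds z, ∀ k ∈ Finset.range (B.returnTime z),
        f ((T ^ (k : ℤ)) (y : X)) = f ((T ^ (k : ℤ)) z) := by
      rw [Filter.eventually_all_finset]
      intro k _
      have hc : Continuous fun y : B.carrier => f ((T ^ (k : ℤ)) (y : X)) :=
        hf.comp ((T ^ (k : ℤ)).continuous.comp continuous_subtype_val)
      exact hc.continuousAt.eventually ((isOpen_discrete {f ((T ^ (k : ℤ)) (z : X))}).mem_nhds rfl)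
    filter_upwards [h1, h2] with y hy1 hy2
    refine Equiv.Perm.sigma_fin_eq hy1 fun k hk hk' => ?_
    have e1 := hα y ⟨k, hk⟩
    have e2 := hα z ⟨k, hk'⟩
    have e3 := hy2 k (Finset.mem_range.2 hk')
    exact Int.ofNat_inj.1 (e1.trans ((congrArg (fun t => (k : ℤ) + t) e3).trans e2.symm))
  · ext y
    obtain ⟨z, k, rfl⟩ := B.exists_eq_zpow y
    rw [B.towerPerm_apply, hα, add_comm, zpow_add_apply]
    exact hgf _

/-- No inversion involves two towers, since the half orbit of the next base point is preserved. -/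
theorem Base.sum_rowSum_inversionKernel (hT : IsAperiodic T) (B : Base T)
    {g : topologicalFullGroup T} {f : X → ℤ} (hgf : ∀ x, (g : X ≃ₜ X) x = (T ^ f x) x)
    (hB : ∀ z ∈ B.carrier, ∀ n : ℤ, 0 ≤ n ↔ 0 ≤ n + f ((T ^ n) z)) (z : B.carrier)
    (σ : Equiv.Perm (Fin (B.returnTime z)))
    (hσ : ∀ k, (σ k : ℤ) = k + f ((T ^ (k : ℤ)) z)) (i : Fin (B.returnTime z)) :
    rowSum (inversionKernel T g) ((T ^ (i : ℤ)) z) =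
      ∑ j ∈ Finset.Ioi i, if σ j < σ i then 1 else 0 := by
  classical
  have key : ∀ j : Fin (B.returnTime z), (g : X ≃ₜ X) ((T ^ (j : ℤ)) z) = (T ^ (σ j : ℤ)) z := by
    intro j
    rw [hσ, add_comm, zpow_add_apply, hgf]
  rw [rowSum, finsum_eq_sum_of_support_subset (s := (Finset.Ioi i).image
    fun j : Fin (B.returnTime z) => (T ^ (j : ℤ)) (z : X)), Finset.sum_image]
  · refine Finset.sum_congr rfl fun j hj => ?_
    rw [hT.inversionKernel_eq rfl rfl (key i) (key j)]
    have := Finset.mem_Ioi.1 hj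
    exact if_congr (by simpa using fun _ => this) rfl rfl
  · intro a _ b _ hab
    exact Fin.ext (by exact_mod_cast hT.eq_of_zpow_eq hab)
  · intro q hq
    have h1 : OrbitLT T ((T ^ (i : ℤ)) z) q ∧
        OrbitLT T ((g : X ≃ₜ X) q) ((g : X ≃ₜ X) ((T ^ (i : ℤ)) z)) := by
      by_contra h1
      exact hq (if_neg h1)
    obtain ⟨⟨n, hn, rfl⟩, h2⟩ := h1
    rw [← zpow_add_apply] at h2 ⊢
    rw [key i, hgf, ← zpow_add_apply, hT.orbitLT_zpow_iff] at h2
    have h3 : n + i < B.returnTime z := by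
      by_contra! hle
      have h := hB _ (B.zpow_returnTime_mem z) (n + i - B.returnTime z)
      rw [← zpow_add_apply, sub_add_cancel] at h
      have := (σ i).2
      omega
    simp only [Finset.coe_image, Set.mem_image, Finset.coe_Ioi, Set.mem_Ioi]
    refine ⟨⟨(n + i).toNat, by omega⟩, ?_, ?_⟩
    · rw [Fin.lt_def]
      simp only
      omega
    · simp only
      rw [Int.toNat_of_nonneg (by omega)]

/-- An element of the commutator subgroup that preserves a half orbit. -/
theorem isSqOneMulConj_of_forall_le_iff [CompactSpace X] [T2Space X] (hmin : IsMinimalHomeo T)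
    (hT : IsAperiodic T) {g : topologicalFullGroup T}
    (hg : g ∈ commutator (topologicalFullGroup T)) {f : X → ℤ} (hf : Continuous f)
    (hgf : ∀ x, (g : X ≃ₜ X) x = (T ^ f x) x) {N : ℕ} (hN : ∀ x, |f x| ≤ N) (w : X)
    (hw : ∀ n : ℤ, 0 ≤ n ↔ 0 ≤ n + f ((T ^ n) w)) : IsSqOneMulConj g := by
  obtain ⟨u, hu, hinv⟩ := rowSum_inversionKernel_mem hT hg
  -- On this base `u` is constant and `f` agrees with its values along the orbit of `w` in the
  -- window `[-N, N]`; outside the window the half orbit condition is automatic.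
  obtain ⟨B, hB⟩ := hmin.exists_base
    (U := u ⁻¹' {u w} ∩ ⋂ n ∈ Finset.Icc (-(N : ℤ)) N,
      (fun z => f ((T ^ n) z)) ⁻¹' {f ((T ^ n) w)})
    (((isClopen_discrete _).preimage hu).inter (isClopen_biInter_finset fun n _ =>
      (isClopen_discrete _).preimage (hf.comp (T ^ n).continuous)))
    ⟨w, rfl, Set.mem_iInter₂.2 fun _ _ => rfl⟩
  have hBu : ∀ z ∈ B.carrier, u z = u w := by
    intro z hz
    rw [hB] at hz
    exact hz.1
  have hBf : ∀ z ∈ B.carrier, ∀ n : ℤ, 0 ≤ n ↔ 0 ≤ n + f ((T ^ n) z) := by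
    intro z hz n
    by_cases hn : n ∈ Finset.Icc (-(N : ℤ)) N
    · rw [hB] at hz
      have h : f ((T ^ n) z) = f ((T ^ n) w) := Set.mem_iInter₂.1 hz.2 n hn
      rw [h]
      exact hw n
    · rw [Finset.mem_Icc] at hn
      have := abs_le.1 (hN ((T ^ n) z))
      omega
  obtain ⟨α, h1, h2, h3⟩ := B.exists_towerPerm_eq hT hf hgf hBf
  refine B.isSqOneMulConj_of_toPerm_eq h2 (fun z => ?_) h3
  refine Equiv.Perm.sign_eq_one_of_sum_eq_zero ?_
  rw [← Finset.sum_congr rfl fun i _ =>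
    B.sum_rowSum_inversionKernel hT hgf hBf z (α z) (h1 z) i]
  have h4 : ∀ i : ℕ, rowSum (inversionKernel T g) ((T ^ (i : ℤ)) z) =
      u ((T ^ (i : ℤ)) z) - u ((T ^ ((i + 1 : ℕ) : ℤ)) z) := by
    intro i
    rw [hinv]
    push_cast
    rw [add_comm, zpow_add_apply, zpow_one]
  -- The sum telescopes to the difference of `u` at two consecutive base points.
  rw [Fin.sum_univ_eq_sum_range (fun i => rowSum (inversionKernel T g) ((T ^ (i : ℤ)) z)),
    Finset.sum_congr rfl fun i _ => h4 i,
    Finset.sum_range_sub' fun i : ℕ => u ((T ^ (i : ℤ)) (z : X)),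
    hBu _ (B.zpow_returnTime_mem z)]
  simp [hBu z z.2]

/-! ### Correction near `w` by an even permutation of finitely many levels -/

open Classical in
/-- The extension of a permutation of an initial segment to a longer segment. -/
noncomputable def extendFin {m : ℕ} (γ : Equiv.Perm (Fin m)) (n : ℕ) : Equiv.Perm (Fin n) :=
  if h : m ≤ n then γ.viaFintypeEmbedding (Fin.castLEEmb h) else 1

theorem sign_extendFin {m : ℕ} {γ : Equiv.Perm (Fin m)} (hγ : Equiv.Perm.sign γ = 1) (n : ℕ) :
    Equiv.Perm.sign (extendFin γ n) = 1 := by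
  unfold extendFin
  split_ifs
  · rw [Equiv.Perm.viaFintypeEmbedding_sign, hγ]
  · simp

theorem extendFin_apply_lt {m n : ℕ} (γ : Equiv.Perm (Fin m)) (h : m ≤ n) (k : Fin n)
    (hk : (k : ℕ) < m) : (extendFin γ n k : ℕ) = γ ⟨k, hk⟩ := by
  rw [extendFin, dif_pos h]
  have := γ.viaFintypeEmbedding_apply_image (Fin.castLEEmb h) ⟨k, hk⟩
  exact congrArg Fin.val this

theorem extendFin_apply_le {m n : ℕ} (γ : Equiv.Perm (Fin m)) (k : Fin n)
    (hk : m ≤ (k : ℕ)) : extendFin γ n k = k := by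
  unfold extendFin
  split_ifs with h
  · refine γ.viaFintypeEmbedding_apply_notMem_range _ ?_
    rintro ⟨j, hj⟩
    have := congrArg Fin.val hj
    simp at this
    omega
  · rfl

/-- Multiplying by a permutation of finitely many levels near `w` makes an element of index zero
preserve the half orbit of `w`. -/
theorem exists_mul_isSqOneMulConj [CompactSpace X] [T2Space X] [TotallyDisconnectedSpace X]
    [Infinite X] (hmin : IsMinimalHomeo T) {g : topologicalFullGroup T}
    (hg : g ∈ commutator (topologicalFullGroup T)) :
    ∃ a b : topologicalFullGroup T, IsSqOneMulConj a ∧ IsSqOneMulConj b ∧ g = a * b := by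
  classical
  have hT := hmin.isAperiodic
  -- `2 ≤ N` provides the two nonnegative levels `N` and `N + 1` used to adjust the parity of `γ`.
  obtain ⟨f, hf, hgf, N, hN, h2N⟩ : ∃ f : X → ℤ, Continuous f ∧
      (∀ x, (g : X ≃ₜ X) x = (T ^ f x) x) ∧ ∃ N : ℕ, (∀ x, |f x| ≤ N) ∧ 2 ≤ N := by
    obtain ⟨f, hf, hgf, N, hN⟩ := exists_cocycle g
    refine ⟨f, hf, hgf, N + 2, fun x => (hN x).trans (by push_cast; omega), by omega⟩
  obtain ⟨w⟩ : Nonempty X := inferInstance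
  let p : Fin (2 * N) → Prop := fun k => (0 : ℤ) ≤ k - N
  let q : Fin (2 * N) → Prop := fun k => (0 : ℤ) ≤ f ((T ^ ((k : ℤ) - N)) w) + (k - N)
  -- This is the vanishing of the index.
  have hcard : Fintype.card {k // p k} = Fintype.card {k // q k} := by
    have h := sum_forwardIndicator_sub_eq_zero hT w hg hgf hN
    simp only [hgf, ← zpow_add_apply, hT.forwardIndicator_zpow] at h
    rw [Finset.sum_sub_distrib, Finset.sum_boole, Finset.sum_boole] at h
    rw [Fintype.card_subtype, Fintype.card_subtype]
    simp only [p, q]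
    omega
  obtain ⟨γ, hγ, hpq⟩ := Equiv.Perm.exists_sign_eq_one_iff p q hcard
    (a := ⟨N, by omega⟩) (b := ⟨N + 1, by omega⟩) (by simp) (by simp [p]) (by simp [p])
  -- The base contains `T ^ (-N) w`, and all towers have at least `2 * N` levels, so one tower
  -- contains the whole window around `w`.
  obtain ⟨B, hxB, hBr⟩ := hmin.exists_base_le_returnTime hT ((T ^ (-(N : ℤ))) w) (2 * N)
  have hα : IsLocallyConstant (B.code fun z => extendFin γ (B.returnTime z)) :=
    (B.isLocallyConstant_returnTime.comp_continuous continuous_subtype_val).comp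
      fun n => (⟨n, extendFin γ n⟩ : Σ n, Equiv.Perm (Fin n))
  obtain ⟨c, hc⟩ := B.exists_toPerm_eq_towerPerm hα
  have hcs := B.isSqOneMulConj_of_toPerm_eq hα (fun z => sign_extendFin hγ _) hc
  have hcc : c ∈ commutator (topologicalFullGroup T) := by
    rw [commutator_eq_closure]
    exact Subgroup.subset_closure hcs.mem_commutatorSet
  refine ⟨g * c, c⁻¹, ?_, hcs.inv, by group⟩
  obtain ⟨f', hf', hgf', N', hN'⟩ := exists_cocycle (g * c)
  refine isSqOneMulConj_of_forall_le_iff hmin hT (mul_mem hg hcc) hf' hgf' hN' w fun n => ?_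
  obtain ⟨z, k, hzk⟩ := B.exists_eq_zpow ((T ^ n) w)
  obtain ⟨m, rfl⟩ : ∃ m : ℤ, n = m + k := ⟨n - k, by ring⟩
  have hz : (z : X) = (T ^ m) w := by
    rw [add_comm, zpow_add_apply] at hzk
    exact ((T ^ (k : ℤ)).injective hzk).symm
  set k' := extendFin γ (B.returnTime z) k with hk'
  have hcy : (c : X ≃ₜ X) ((T ^ (m + k)) w) = (T ^ (m + k')) w := by
    have h : (toPerm T c) ((T ^ (k : ℤ)) z) = (T ^ (k' : ℤ)) z := by
      rw [hc, B.towerPerm_apply]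
    rw [hzk, add_comm, zpow_add_apply, ← hz]
    exact h
  have hpos : f' ((T ^ (m + k)) w) + (m + k) = f ((T ^ (m + k')) w) + (m + k') := by
    have h := hgf' ((T ^ (m + k)) w)
    rw [Subgroup.coe_mul, Homeomorph.mul_apply, hcy, hgf, ← zpow_add_apply,
      ← zpow_add_apply] at h
    exact (hT.eq_of_zpow_eq h).symm
  rw [add_comm (m + (k : ℤ)) (f' _), hpos]
  have hfb := abs_le.1 (hN ((T ^ (m + k')) w))
  have hkr := k.2
  have hkr' := k'.2
  -- A tower starting before `-N` ends before the window, and one starting later begins at `N` or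
  -- beyond; there `c` stays in the tower and `g` moves too little to cross. In the tower at `-N`,
  -- `γ` was chosen to undo the crossings.
  rcases lt_trichotomy m (-N) with hm | hm | hm
  · have h := B.returnTime_le (x := z) (n := -N - m) (by omega) (by
      rw [hz, ← zpow_add_apply, sub_add_cancel]
      exact hxB)
    omega
  · subst hm
    by_cases hk : (k : ℕ) < 2 * N
    · have h1 := hpq ⟨k, hk⟩
      have h2 := extendFin_apply_lt γ (hBr z z.2) k hk
      rw [← hk'] at h2
      simp only [p, q, ← h2] at h1
      rw [neg_add_eq_sub, neg_add_eq_sub]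
      exact h1.symm
    · have h2 := extendFin_apply_le γ k (not_lt.1 hk)
      rw [← hk'] at h2
      rw [h2] at hfb ⊢
      omega
  · have h := B.returnTime_le (x := (T ^ (-(N : ℤ))) w) (n := m + N) (by omega) (by
      rw [← zpow_add_apply, add_neg_cancel_right, ← hz]
      exact z.2)
    have := hBr _ hxB
    omega

/-! ### The finite case and the conclusion -/

/-- In a finite discrete space dense orbits make the action transitive, so every permutation lies in
the full group, and the commutator subgroup has even elements only. -/
theorem isSqOneMulConj_of_finite [T1Space X] [Finite X] (hmin : IsMinimalHomeo T)
    {g : topologicalFullGroup T} (hg : g ∈ commutator (topologicalFullGroup T)) :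
    IsSqOneMulConj g := by
  classical
  have := Fintype.ofFinite X
  have hsurj : ∀ S : Equiv.Perm X, ∃ g : topologicalFullGroup T, toPerm T g = S := by
    intro S
    have h : ∀ x, ∃ n : ℤ, S x = (T ^ n) x := by
      intro x
      have : S x ∈ Set.range fun n : ℤ => (T ^ n) x := dense_discrete.1 (hmin x) ▸ Set.mem_univ _
      exact this.imp fun _ h => h.symm
    choose f hf using h
    exact exists_toPerm_eq S f continuous_of_discreteTopology hf
  have hsign := Abelianization.commutator_subset_ker (Equiv.Perm.sign.comp (toPerm T)) hg
  obtain ⟨s, h, hs, hgs⟩ := (toPerm T g).isSqOneMulConj_of_sign_eq_one hsign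
  obtain ⟨a, rfl⟩ := hsurj s
  obtain ⟨b, rfl⟩ := hsurj h
  exact ⟨a, b, toPerm_injective (by rw [map_mul, hs, map_one]),
    toPerm_injective (by rw [hgs]; simp)⟩

end TopFullGroup

/-- `(X, T)` ranges over all minimal homeomorphisms of totally disconnected compact metrizable
spaces, hence over all Cantor minimal systems and all minimal subshifts over finite alphabets. -/
theorem mainTheorem8 {X : Type*} [TopologicalSpace X] [CompactSpace X]
    [TopologicalSpace.MetrizableSpace X] [TotallyDisconnectedSpace X]
    (T : X ≃ₜ X) (hT : IsMinimalHomeo T) :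
    (∀ g ∈ commutator (topologicalFullGroup T),
      ∃ l : List (topologicalFullGroup T), l.length ≤ 2 ∧
        (∀ c ∈ l, c ∈ commutatorSet (topologicalFullGroup T)) ∧ g = l.prod) ∧
    (∀ g ∈ commutator (topologicalFullGroup T),
      ∃ l : List (topologicalFullGroup T), l.length ≤ 4 ∧
        (∀ s ∈ l, orderOf s = 2) ∧ g = l.prod) := by
  have key : ∀ g ∈ commutator (topologicalFullGroup T), ∃ a b : topologicalFullGroup T,
      IsSqOneMulConj a ∧ IsSqOneMulConj b ∧ g = a * b := by
    intro g hg
    rcases finite_or_infinite X with h | h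
    · exact ⟨g, 1, TopFullGroup.isSqOneMulConj_of_finite hT hg, .one, (mul_one g).symm⟩
    · exact TopFullGroup.exists_mul_isSqOneMulConj hT hg
  refine ⟨fun g hg => ?_, fun g hg => ?_⟩
  · obtain ⟨a, b, ha, hb, rfl⟩ := key g hg
    refine ⟨[a, b], le_rfl, ?_, by simp⟩
    simpa using ⟨ha.mem_commutatorSet, hb.mem_commutatorSet⟩
  · obtain ⟨a, b, ha, hb, rfl⟩ := key g hg
    obtain ⟨s, t, hs, ht, rfl⟩ := ha.exists_mul_self_eq_one
    obtain ⟨s', t', hs', ht', rfl⟩ := hb.exists_mul_self_eq_one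
    obtain ⟨l, h1, h2, h3⟩ := exists_list_orderOf_eq_two [s, t, s', t']
      (by simp [hs, ht, hs', ht'])
    exact ⟨l, h1, h2, by rw [← h3]; simp [mul_assoc]⟩
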